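/- For $z$ in the upper half-plane put $q=e^{2\pi i z}$, let $E_4=1+240\sum_{n\ge 1}\bigl(\sum_{d\mid n}d^3\bigr)q^n$ and $\Delta=q\prod_{n\ge 1}(1-q^n)^{24}$, and let $f=E_4^6\,\Delta+2\Delta^3$, a cusp form of weight $36$ on $\mathrm{SL}_2(\mathbb Z)$. For $n\ge 1$ let $T_n$ be the $n$th Hecke operator at level $1$ and weight $36$, $$(T_nf)(z)=n^{35}\sum_{d\mid n}d^{-36}\sum_{0\le b<d}f\!\left(\frac{(n/d)z+b}{d}\right),$$ and let $a_n(f)$ be the coefficient of $q^n$ in the $q$-expansion of $f$. Then the reduction of $f$ modulo $4$ is a weak eigenform modulo $4$. That is: $a_1(f)=1$; the $q$-expansions of $f$ and of all $T_nf$ ($n\ge 1$) have integer coefficients; and for every $n\ge 1$ $$T_nf\equiv a_n(f)\,f \pmod 4,$$ where the congruence means that the $q$-expansions agree term-wise modulo $4$, i.e. have the same image in $(\mathbb Z/4\mathbb Z)[[q]]$. -/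

import Mathlib

open UpperHalfPlane ModularForm

open scoped MatrixGroups PowerSeries

noncomputable section

namespace WeakEigenform

/-- The integral matrix `(a b; 0 d)` of determinant `n`, where `d ∣ n` and `a = n / d`. -/
def heckeMatrix (n : ℕ) (d : n.divisors) (b : ℕ) : GL (Fin 2) ℝ :=
  Matrix.GeneralLinearGroup.mkOfDetNeZero !![((n / (d : ℕ) : ℕ) : ℝ), (b : ℝ); 0, ((d : ℕ) : ℝ)]
    (by
      obtain ⟨d, hd⟩ := d
      obtain ⟨hdn, hn⟩ := Nat.mem_divisors.mp hd
      have hd0 : d ≠ 0 := ne_zero_of_dvd_ne_zero hn hdn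
      have ha0 : n / d ≠ 0 := (Nat.div_pos (Nat.le_of_dvd (Nat.pos_of_ne_zero hn) hdn)
        (Nat.pos_of_ne_zero hd0)).ne'
      rw [Matrix.det_fin_two_of, mul_zero, sub_zero]
      exact mul_ne_zero (Nat.cast_ne_zero.mpr ha0) (Nat.cast_ne_zero.mpr hd0))

/-- The `n`-th Hecke operator of level `1` and weight `k` (for `1 ≤ n`), as the sum of the weight
`k` slash translates of `h` by the representatives `(a b; 0 d)`, `a * d = n`, `0 ≤ b < d`, of the
left `SL(2, ℤ)`-cosets of integral matrices of determinant `n`. Mathlib's slash action carries the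
factor `det ^ (k - 1)`, so that this is the classical normalisation, spelled out in
`heckeOperator_apply`. -/
def heckeOperator (k : ℤ) (n : ℕ) (h : ℍ → ℂ) : ℍ → ℂ :=
  ∑ d : n.divisors, ∑ b ∈ Finset.range (d : ℕ), h ∣[k] heckeMatrix n d b

/-- `(T_n h)(z) = n ^ (k - 1) * ∑_{d ∣ n} d ^ (-k) * ∑_{0 ≤ b < d} h ((n / d * z + b) / d)`. -/
theorem heckeOperator_apply (k : ℤ) (n : ℕ) (h : ℍ → ℂ) (z : ℍ) :
    heckeOperator k n h z = (n : ℂ) ^ (k - 1) * ∑ d ∈ n.divisors, (d : ℂ) ^ (-k) *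
      ∑ b ∈ Finset.range d, h (ofComplex ((((n / d : ℕ) : ℂ) * z + b) / d)) := by
  rw [← Finset.sum_coe_sort n.divisors]
  simp only [heckeOperator, Finset.sum_apply, Finset.mul_sum]
  refine Finset.sum_congr rfl fun d _ ↦ Finset.sum_congr rfl fun b _ ↦ ?_
  obtain ⟨d, hd⟩ := d
  obtain ⟨hdn, hn⟩ := Nat.mem_divisors.mp hd
  have hval : (heckeMatrix n ⟨d, hd⟩ b).val = !![((n / d : ℕ) : ℝ), (b : ℝ); 0, (d : ℝ)] := rfl
  have hdet : (heckeMatrix n ⟨d, hd⟩ b).det.val = n := by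
    rw [Matrix.GeneralLinearGroup.val_det_apply, hval, Matrix.det_fin_two_of, mul_zero, sub_zero,
      ← Nat.cast_mul, Nat.div_mul_cancel hdn]
  have hpos : 0 < (heckeMatrix n ⟨d, hd⟩ b).det.val := by
    rw [hdet]; exact_mod_cast Nat.pos_of_ne_zero hn
  have hsm : heckeMatrix n ⟨d, hd⟩ b • z = ofComplex ((((n / d : ℕ) : ℂ) * z + b) / d) := by
    rw [← ofComplex_apply (heckeMatrix n ⟨d, hd⟩ b • z), coe_smul_of_det_pos hpos]
    simp [num, denom, hval]
  rw [slash_apply, hsm, hdet]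
  have hσ : σ (heckeMatrix n ⟨d, hd⟩ b) = ContinuousAlgEquiv.refl ℝ ℂ := if_pos hpos
  simp [hσ, denom, hval]
  ring

/-- `g` has integral Fourier expansion in `q = exp (2πiz)`, and `G` is the term-wise reduction of
this expansion modulo `M`. -/
def ReducesTo (M : ℕ) (g : ℍ → ℂ) (G : (ZMod M)⟦X⟧) : Prop :=
  ∃ F : ℤ⟦X⟧, F.map (Int.castRingHom ℂ) = qExpansion 1 g ∧ F.map (Int.castRingHom (ZMod M)) = G

/-- The reduction modulo `M` of the cusp form `h` of weight `k` on `SL(2, ℤ)` with integral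
Fourier coefficients is a weak eigenform: `h` is normalized, and for every `n ≥ 1` the reduction
of `T_n h` is `a_n(h)` times the reduction of `h`. -/
def IsWeakEigenform (M : ℕ) {k : ℤ} (h : CuspForm 𝒮ℒ k) : Prop :=
  (qExpansion 1 h).coeff 1 = 1 ∧
    ∃ H : (ZMod M)⟦X⟧, ReducesTo M h H ∧
      ∀ n : ℕ, 1 ≤ n → ReducesTo M (heckeOperator k n h) (H.coeff n • H)

/-- The cusp form `f = E₄ ^ 6 * Δ + 2 * Δ ^ 3` of weight `36` on `SL(2, ℤ)`. -/
def f : CuspForm 𝒮ℒ 36 :=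
  (CuspForm.ofMulDiscriminant (ModularForm.mcast (by norm_num) (E₄.pow 6)) +
    (2 : ℂ) • CuspForm.ofMulDiscriminant
      (ModularForm.mcast (by norm_num) (CuspForm.discriminant.toModularFormₗ.pow 2))).copy
    (fun z ↦ E₄ z ^ 6 * ModularForm.discriminant z + 2 * ModularForm.discriminant z ^ 3)
    (by
      ext z
      change _ = ModularForm.discriminant z * E₄ z ^ 6 +
        2 * (ModularForm.discriminant z * ModularForm.discriminant z ^ 2)
      ring) rfl

/-- `f` is literally `E₄ ^ 6 * Δ + 2 * Δ ^ 3` for Mathlib's `E₄` and `Δ`. -/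
theorem f_apply (z : ℍ) :
    f z = E₄ z ^ 6 * CuspForm.discriminant z + 2 * CuspForm.discriminant z ^ 3 := rfl

end WeakEigenform

end

/-!
# `E₄ ^ 6 * Δ + 2 * Δ ^ 3` is a weak eigenform modulo `4`

Write `a_m` for the coefficient at `q ^ m`. The Hecke operator satisfies
`a_m (T_n f) = ∑ e ∣ gcd (m, n), e ^ 35 * a_{m n / e ^ 2} (f)` (`coeff_heckeForm`), so that `T_n f`
is integral when `f` is, and the formula is symmetric: `a_m (T_n f) = a_n (T_m f)`.

The operator `T_n` preserves modular forms of level one (`heckeForm`), as right multiplication by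
`SL(2, ℤ)` permutes the left orbits of integral matrices of determinant `n`. By a congruence form
of the Sturm bound (`dvd_coeff_of_forall_le`), a form of weight `36` with integral `q`-expansion
vanishes modulo `4` as soon as its coefficients up to `q ^ 3` do. Indeed the forms
`E₄ ^ (9 - 3 * i) * Δ ^ i` have integral expansions starting with `q ^ i`, so they clear the first
coefficients over `ℤ`.

Hence `T_n f ≡ a_n f` has to be checked at `q ^ 0, …, q ^ 3` only (`heckeSeries_mod`). It is clear
at `q ^ 0` and `q ^ 1`, since `a_0 = 0` and `a_1 = 1`. For `p = 2, 3` the symmetry turns the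
coefficient of `T_n f` at `q ^ p` into the coefficient of `T_p f` at `q ^ n`, which leaves the two
congruences `T_p f ≡ a_p f`. By the same bound, these follow from the coefficients of `f` up to `q ^ 9`, which
are `0, 1, 0, 2, 0, 2, 0, 0, 0, 1` modulo `4`. They are read off from `f ≡ Δ + 2 Δ ^ 3` and from the
expression of `Δ` by divisor sums that `1728 Δ = E₄ ^ 3 - E₆ ^ 2` provides.
-/

/-! ### Orbits of integral matrices of fixed determinant -/

namespace FixedDetMatrices

variable {n : ℕ}

/-- An integral matrix of determinant `n ≠ 0`, as an element of `GL(2, ℝ)`. -/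
noncomputable def toGL (hn : n ≠ 0) (A : FixedDetMatrix (Fin 2) ℤ (n : ℤ)) : GL (Fin 2) ℝ :=
  Matrix.GeneralLinearGroup.mkOfDetNeZero (A.1.map (Int.castRingHom ℝ)) (by
    have h : (A.1.map (Int.castRingHom ℝ)).det = (Int.castRingHom ℝ) A.1.det :=
      ((Int.castRingHom ℝ).map_det A.1).symm
    rw [h, A.2]
    simpa using hn)

/-- Right multiplication of an integral matrix of determinant `n` by a matrix in `SL(2, ℤ)`. -/
def mulRight (A : FixedDetMatrix (Fin 2) ℤ (n : ℤ)) (γ : SL(2, ℤ)) :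
    FixedDetMatrix (Fin 2) ℤ (n : ℤ) :=
  ⟨A.1 * γ.1, by rw [Matrix.det_mul, A.2, γ.2, mul_one]⟩

lemma toGL_smul (hn : n ≠ 0) (γ : SL(2, ℤ)) (A : FixedDetMatrix (Fin 2) ℤ (n : ℤ)) :
    toGL hn (γ • A) = Matrix.SpecialLinearGroup.mapGL ℝ γ * toGL hn A := by
  ext i j
  simp [toGL, smul_coe, Matrix.GeneralLinearGroup.mkOfDetNeZero, Matrix.mul_apply]

lemma toGL_mulRight (hn : n ≠ 0) (γ : SL(2, ℤ)) (A : FixedDetMatrix (Fin 2) ℤ (n : ℤ)) :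
    toGL hn (mulRight A γ) = toGL hn A * Matrix.SpecialLinearGroup.mapGL ℝ γ := by
  ext i j
  simp [toGL, mulRight, Matrix.GeneralLinearGroup.mkOfDetNeZero, Matrix.mul_apply]

lemma smul_mulRight (γ δ : SL(2, ℤ)) (A : FixedDetMatrix (Fin 2) ℤ (n : ℤ)) :
    mulRight (γ • A) δ = γ • mulRight A δ := by
  apply ext'
  rw [smul_coe]
  exact Matrix.mul_assoc _ _ _

lemma mulRight_injective (δ : SL(2, ℤ)) :
    Function.Injective fun A : FixedDetMatrix (Fin 2) ℤ (n : ℤ) ↦ mulRight A δ := by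
  intro A B h
  have h' : A.1 * δ.1 = B.1 * δ.1 := congrArg Subtype.val h
  apply ext'
  have h2 := congrArg (· * (δ⁻¹).1) h'
  have h3 : δ.1 * (δ⁻¹).1 = 1 := congrArg Subtype.val (mul_inv_cancel δ)
  simpa only [Matrix.mul_assoc, h3, Matrix.mul_one] using h2

lemma exists_smul_eq_reduce {m : ℤ} (A : FixedDetMatrix (Fin 2) ℤ m) :
    ∃ γ : SL(2, ℤ), γ • A = reduce A := by
  induction A using reduce_rec with
  | base A h =>
    by_cases h1 : 0 < A.1 0 0
    · exact ⟨_, (reduce_of_pos h h1).symm⟩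
    · rw [reduce_of_not_pos h h1]
      simp only [← mul_smul]
      exact ⟨_, rfl⟩
  | step A h ih =>
    obtain ⟨γ, hγ⟩ := ih
    rw [reduce_reduceStep h] at hγ
    simp only [reduceStep, ← mul_smul] at hγ
    exact ⟨_, hγ⟩

/-- An `SL(2, ℤ)`-orbit of integral matrices of determinant `n` contains at most one
representative. -/
lemma eq_of_smul_eq_of_mem_reps {A B : FixedDetMatrix (Fin 2) ℤ (n : ℤ)}
    (hA : A ∈ reps (n : ℤ)) (hB : B ∈ reps (n : ℤ)) {γ : SL(2, ℤ)} (h : γ • A = B) : A = B := by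
  obtain ⟨A10, A00, A01, A11⟩ := hA
  obtain ⟨B10, B00, B01, B11⟩ := hB
  have hd := A.2
  have hd' := B.2
  have hg := γ.2
  rw [Matrix.det_fin_two] at hd hd' hg
  have key : ∀ i j, B.1 i j = γ.1 i 0 * A.1 0 j + γ.1 i 1 * A.1 1 j := by
    intro i j
    rw [← h, smul_coe, Matrix.mul_apply, Fin.sum_univ_two]
  have k00 := key 0 0
  have k01 := key 0 1
  have k10 := key 1 0
  have k11 := key 1 1
  simp only [A10, mul_zero, add_zero, sub_zero] at k00 k01 k10 k11 hd hg
  have g10 : γ.1 1 0 = 0 := by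
    rcases mul_eq_zero.mp (k10.symm.trans B10) with h0 | h0
    · exact h0
    · exact absurd h0 A00.ne'
  rw [g10, mul_zero, sub_zero] at hg
  have g00 : γ.1 0 0 = 1 := by
    rcases Int.eq_one_or_neg_one_of_mul_eq_one hg with h0 | h0
    · exact h0
    · rw [h0] at k00; lia
  have g11 : γ.1 1 1 = 1 := by rwa [g00, one_mul] at hg
  rw [g10, g11] at k11
  rw [g00] at k00 k01
  simp only [one_mul, zero_mul, zero_add] at k00 k01 k11
  rw [k11, abs_of_nonneg B01] at B11
  rw [abs_of_nonneg A01] at A11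
  have hdiff : B.1 0 1 - A.1 0 1 = 0 := by
    refine Int.eq_zero_of_abs_lt_dvd (m := |A.1 1 1|) ?_ (abs_lt.mpr ⟨by lia, by lia⟩)
    rw [abs_dvd, k01, add_sub_cancel_left]
    exact dvd_mul_left _ _
  ext i j
  fin_cases i <;> fin_cases j
  · exact k00.symm
  · exact (sub_eq_zero.mp hdiff).symm
  · exact A10.trans B10.symm
  · exact k11.symm

variable {k : ℤ}

lemma slash_toGL_smul (hn : n ≠ 0) {h : ℍ → ℂ} (hh : ∀ γ : SL(2, ℤ), h ∣[k] γ = h)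
    (γ : SL(2, ℤ)) (A : FixedDetMatrix (Fin 2) ℤ (n : ℤ)) :
    h ∣[k] toGL hn (γ • A) = h ∣[k] toGL hn A := by
  rw [toGL_smul, SlashAction.slash_mul]
  exact congrArg (· ∣[k] toGL hn A) (hh γ)

/-- The sum of the translates of a modular function by the representatives of the orbits
`SL(2, ℤ) \ {det = n}` is invariant, as right multiplication permutes the orbits. -/
lemma sum_reps_slash (hn : n ≠ 0) {h : ℍ → ℂ} (hh : ∀ γ : SL(2, ℤ), h ∣[k] γ = h)
    (γ : SL(2, ℤ)) :
    (∑ A : reps (n : ℤ), h ∣[k] toGL hn A.1) ∣[k] γ = ∑ A : reps (n : ℤ), h ∣[k] toGL hn A.1 := by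
  have hn' : (n : ℤ) ≠ 0 := by exact_mod_cast hn
  let e : reps (n : ℤ) → reps (n : ℤ) :=
    fun A ↦ ⟨reduce (mulRight A.1 γ), reduce_mem_reps hn' _⟩
  have he : Function.Bijective e := by
    refine Finite.injective_iff_bijective.mp fun A B hAB ↦ Subtype.ext ?_
    have h1 : reduce (mulRight A.1 γ) = reduce (mulRight B.1 γ) := congrArg Subtype.val hAB
    obtain ⟨α, hα⟩ := exists_smul_eq_reduce (mulRight A.1 γ)
    obtain ⟨β, hβ⟩ := exists_smul_eq_reduce (mulRight B.1 γ)
    refine eq_of_smul_eq_of_mem_reps A.2 B.2 (γ := β⁻¹ * α) (mulRight_injective γ ?_)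
    change mulRight _ γ = mulRight _ γ
    rw [smul_mulRight, mul_smul, hα, h1, ← hβ, inv_smul_smul]
  rw [SlashAction.sum_slash]
  refine (Finset.sum_congr rfl fun A _ ↦ ?_).trans
    (he.sum_comp fun A : reps (n : ℤ) ↦ h ∣[k] toGL hn A.1)
  obtain ⟨α, hα⟩ := exists_smul_eq_reduce (mulRight A.1 γ)
  change _ = h ∣[k] toGL hn (reduce (mulRight A.1 γ))
  rw [← hα, slash_toGL_smul hn hh, toGL_mulRight, SlashAction.slash_mul]
  rfl

end FixedDetMatrices

/-! ### Hecke operators preserve modular forms of level one -/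

namespace WeakEigenform

open FixedDetMatrices

variable {k : ℤ} {n : ℕ}

/-- The matrices `(a b; 0 d)` in the definition of `T_n` are exactly the elements of `reps n`. -/
lemma heckeOperator_eq_sum_reps (hn : n ≠ 0) (h : ℍ → ℂ) :
    heckeOperator k n h = ∑ A : reps (n : ℤ), h ∣[k] toGL hn A.1 := by
  rw [heckeOperator, Finset.sum_sigma']
  refine Finset.sum_bij (fun x hx ↦ ⟨⟨!![((n / (x.1 : ℕ) : ℕ) : ℤ), (x.2 : ℤ); 0, ((x.1 : ℕ) : ℤ)],
    ?_⟩, ?_⟩) ?_ ?_ ?_ ?_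
  · rw [Matrix.det_fin_two_of, mul_zero, sub_zero, ← Nat.cast_mul,
      Nat.div_mul_cancel (Nat.dvd_of_mem_divisors x.1.2)]
  · have hd : 0 < (x.1 : ℕ) := Nat.pos_of_mem_divisors x.1.2
    have ha : 0 < n / (x.1 : ℕ) := Nat.div_pos (Nat.divisor_le x.1.2) hd
    have hb : x.2 < (x.1 : ℕ) := by simpa using hx
    refine ⟨rfl, ?_, ?_, ?_⟩
    · exact Int.natCast_pos.mpr ha
    · simp
    · simpa using hb
  · simp
  · rintro ⟨⟨d, hd⟩, b⟩ _ ⟨⟨d', hd'⟩, b'⟩ _ h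
    have h1 := congrArg (fun A : reps (n : ℤ) ↦ A.1.1 1 1) h
    have h2 := congrArg (fun A : reps (n : ℤ) ↦ A.1.1 0 1) h
    simp at h1 h2
    subst h1 h2
    rfl
  · rintro ⟨A, h10, h00, h01, h11⟩ _
    have hd := A.2
    rw [Matrix.det_fin_two, h10, mul_zero, sub_zero] at hd
    have hn' : 0 < (n : ℤ) := by exact_mod_cast Nat.pos_of_ne_zero hn
    have hpos : 0 < A.1 1 1 := by
      rw [← hd] at hn'
      exact pos_of_mul_pos_right hn' h00.le
    rw [abs_of_nonneg h01, abs_of_pos hpos] at h11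
    obtain ⟨d, hdd⟩ := Int.eq_ofNat_of_zero_le hpos.le
    obtain ⟨a, haa⟩ := Int.eq_ofNat_of_zero_le h00.le
    obtain ⟨b, hbb⟩ := Int.eq_ofNat_of_zero_le h01
    rw [hdd, haa] at hd
    have hd2 : a * d = n := by exact_mod_cast hd
    have hd0 : 0 < d := by lia
    refine ⟨⟨⟨d, Nat.mem_divisors.mpr ⟨⟨a, by rw [← hd2, mul_comm]⟩, hn⟩⟩, b⟩, ?_, ?_⟩
    · simp; lia
    · apply Subtype.ext
      have hnd : n / d = a := by rw [← hd2, Nat.mul_div_cancel _ hd0]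
      ext i j
      fin_cases i <;> fin_cases j
      · simp [hnd, haa]
      · simp [hbb]
      · simp [h10]
      · simp [hdd]
  · rintro ⟨d, b⟩ _
    congr 1
    ext i j
    fin_cases i <;> fin_cases j <;>
      simp [-Int.natCast_ediv, heckeMatrix, toGL, Matrix.GeneralLinearGroup.mkOfDetNeZero]

/-- The Hecke operator `T_n` preserves the modular forms of level one. -/
noncomputable def heckeForm (n : ℕ) (hn : n ≠ 0) (h : ModularForm 𝒮ℒ k) : ModularForm 𝒮ℒ k where
  toFun := heckeOperator k n h
  slash_action_eq' := by
    rintro _ ⟨γ, rfl⟩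
    rw [heckeOperator_eq_sum_reps hn]
    exact sum_reps_slash hn (fun γ ↦ h.slash_action_eq' _ ⟨γ, rfl⟩) γ
  holo' := by
    change MDifferentiable _ _ (heckeOperator k n h)
    rw [heckeOperator]
    exact .sum fun d _ ↦ .sum fun b _ ↦ h.holo'.slash k _
  bdd_at_cusps' {c} hc := by
    rw [OnePoint.isBoundedAt_iff_forall_SL2Z hc]
    intro γ _
    rw [heckeOperator_eq_sum_reps hn,
      sum_reps_slash (h := h) hn fun γ ↦ h.slash_action_eq' _ ⟨γ, rfl⟩, IsBoundedAtImInfty,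
      Filter.BoundedAtFilter, Finset.sum_fn]
    -- each representative is upper triangular, so it fixes the cusp at infinity
    refine .fun_sum fun A _ ↦ ?_
    refine IsBoundedAtImInfty.slash k ?_ (ModularFormClass.bdd_at_infty h)
    simp [toGL, Matrix.GeneralLinearGroup.mkOfDetNeZero, A.2.1]

@[simp]
lemma coe_heckeForm (hn : n ≠ 0) (h : ModularForm 𝒮ℒ k) :
    ⇑(heckeForm n hn h) = heckeOperator k n h := rfl

/-! ### Fourier coefficients of Hecke translates -/

/-- Summing over the translates by `b / d` with `0 ≤ b < d` keeps the terms whose index is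
divisible by `d`. -/
lemma sum_exp_mul_div (d m : ℕ) (hd : d ≠ 0) :
    ∑ b ∈ Finset.range d, Complex.exp (2 * Real.pi * Complex.I * (m * b / d)) =
      if d ∣ m then (d : ℂ) else 0 := by
  have hprim := Complex.isPrimitiveRoot_exp d hd
  set ζ := Complex.exp (2 * Real.pi * Complex.I / d) with hζ
  have hterm : ∀ b ∈ Finset.range d,
      Complex.exp (2 * Real.pi * Complex.I * (m * b / d)) = (ζ ^ m) ^ b := by
    intro b _
    rw [hζ, ← Complex.exp_nat_mul, ← Complex.exp_nat_mul]
    congr 1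
    ring
  rw [Finset.sum_congr rfl hterm]
  split_ifs with h
  · rw [(hprim.pow_eq_one_iff_dvd m).mpr h]
    simp
  · have h1 : ζ ^ m ≠ 1 := fun h1 ↦ h ((hprim.pow_eq_one_iff_dvd m).mp h1)
    have h2 := geom_sum_mul (ζ ^ m) d
    rw [← pow_mul, mul_comm m d, pow_mul, hprim.pow_eq_one, one_pow, sub_self] at h2
    exact (mul_eq_zero.mp h2).resolve_right (sub_ne_zero.mpr h1)

/-- The `q`-expansion of the inner sum of the Hecke operator: the terms with index divisible by
`d` survive, and `q ^ (d * l)` becomes `q ^ (a * l)`. -/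
lemma hasSum_sum_translates (h : ModularForm 𝒮ℒ k) (z : ℍ) {a d : ℕ} (ha : a ≠ 0) (hd : d ≠ 0) :
    HasSum (fun l : ℕ ↦ (d : ℂ) * (qExpansion 1 h).coeff (d * l) *
        Function.Periodic.qParam 1 z ^ (a * l))
      (∑ b ∈ Finset.range d, h (ofComplex (((a : ℂ) * z + b) / d))) := by
  have him : ∀ b : ℕ, 0 < (((a : ℂ) * z + b) / d).im := by
    intro b
    have : (((a : ℂ) * z + b) / d).im = a * z.im / d := by
      rw [Complex.div_natCast_im]; simp
    rw [this]
    have := z.im_pos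
    positivity
  have h1 : HasSum (fun m : ℕ ↦ ∑ b ∈ Finset.range d, (qExpansion 1 h).coeff m *
      Function.Periodic.qParam 1 (((a : ℂ) * z + b) / d) ^ m)
      (∑ b ∈ Finset.range d, h (ofComplex (((a : ℂ) * z + b) / d))) := by
    refine hasSum_sum fun b _ ↦ ?_
    have := ModularForm.hasSum_qExpansion h one_pos one_mem_strictPeriods_SL
      (ofComplex (((a : ℂ) * z + b) / d))
    rwa [ofComplex_apply_of_im_pos (him b)] at this ⊢
  have h2 : ∀ m : ℕ, ∑ b ∈ Finset.range d, (qExpansion 1 h).coeff m *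
      Function.Periodic.qParam 1 (((a : ℂ) * z + b) / d) ^ m =
      (qExpansion 1 h).coeff m * Complex.exp (2 * Real.pi * Complex.I * (m * (a * z) / d)) *
        if d ∣ m then (d : ℂ) else 0 := by
    intro m
    rw [← sum_exp_mul_div d m hd, Finset.mul_sum]
    refine Finset.sum_congr rfl fun b _ ↦ ?_
    rw [mul_assoc, ← Complex.exp_add, Function.Periodic.qParam, ← Complex.exp_nat_mul]
    congr 2
    push_cast
    field_simp
  simp only [h2] at h1
  -- only the indices `m = d * l` contribute
  have hinj : Function.Injective fun l : ℕ ↦ d * l := fun x y hxy ↦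
    Nat.eq_of_mul_eq_mul_left (Nat.pos_of_ne_zero hd) hxy
  rw [← hinj.hasSum_iff] at h1
  · refine (congrArg (HasSum · _) (funext fun l ↦ ?_)).mp h1
    have hexp : Complex.exp (2 * Real.pi * Complex.I * (((d * l : ℕ) : ℂ) * (a * z) / d)) =
        Function.Periodic.qParam 1 z ^ (a * l) := by
      rw [Function.Periodic.qParam, ← Complex.exp_nat_mul]
      congr 1
      push_cast
      field_simp
    simp only [Function.comp_apply, hexp, dvd_mul_right, if_true]
    ring
  · intro m hm
    have : ¬ d ∣ m := fun ⟨l, hl⟩ ↦ hm ⟨l, hl.symm⟩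
    simp [this]

/-- The coefficients of `T_n h`. The formula is symmetric in `m` and `n`. -/
lemma coeff_heckeForm (hn : n ≠ 0) (h : ModularForm 𝒮ℒ k) (m : ℕ) :
    (qExpansion 1 (heckeForm n hn h)).coeff m =
      ∑ e ∈ (m.gcd n).divisors, (e : ℂ) ^ (k - 1) * (qExpansion 1 h).coeff (m * n / e ^ 2) := by
  refine (ModularFormClass.qExpansion_coeff_unique (f := heckeForm n hn h) one_pos
    one_mem_strictPeriods_SL
    (c := fun m ↦ ∑ e ∈ (m.gcd n).divisors,
      (e : ℂ) ^ (k - 1) * (qExpansion 1 h).coeff (m * n / e ^ 2)) (fun z ↦ ?_) m).symm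
  have hn' : (n : ℂ) ≠ 0 := by exact_mod_cast hn
  -- the sum over `d` is rewritten as a sum over `e = n / d`
  rw [coe_heckeForm, heckeOperator_apply, Finset.mul_sum, ← Nat.sum_div_divisors n
    (fun d ↦ (n : ℂ) ^ (k - 1) * ((d : ℂ) ^ (-k) *
      ∑ b ∈ Finset.range d, h (ofComplex ((((n / d : ℕ) : ℂ) * z + b) / d))))]
  have key : ∀ e ∈ n.divisors, HasSum (fun m : ℕ ↦ if e ∣ m then
      (e : ℂ) ^ (k - 1) * (qExpansion 1 h).coeff (m * n / e ^ 2) *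
        Function.Periodic.qParam 1 z ^ m else 0)
      ((n : ℂ) ^ (k - 1) * (((n / e : ℕ) : ℂ) ^ (-k) * ∑ b ∈ Finset.range (n / e),
        h (ofComplex ((((n / (n / e) : ℕ) : ℂ) * z + b) / (n / e : ℕ))))) := by
    intro e he
    obtain ⟨d, hd⟩ := Nat.dvd_of_mem_divisors he
    have he0 : 0 < e := Nat.pos_of_mem_divisors he
    have hd0 : 0 < d := Nat.pos_of_ne_zero fun h0 ↦ hn (by rw [hd, h0, mul_zero])
    have hne : n / e = d := by rw [hd, Nat.mul_div_cancel_left _ he0]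
    have hnd : n / d = e := by rw [hd, Nat.mul_div_cancel _ hd0]
    rw [hne, hnd]
    have h1 := ((hasSum_sum_translates h z he0.ne' hd0.ne').mul_left ((d : ℂ) ^ (-k))).mul_left
      ((n : ℂ) ^ (k - 1))
    have hinj : Function.Injective fun l : ℕ ↦ e * l := fun x y hxy ↦
      Nat.eq_of_mul_eq_mul_left he0 hxy
    rw [← hinj.hasSum_iff]
    · refine (congrArg (HasSum · _) (funext fun l ↦ ?_)).mp h1
      have hidx : e * l * n / e ^ 2 = d * l := by
        rw [hd, show e * l * (e * d) = d * l * e ^ 2 by ring, Nat.mul_div_cancel _ (by positivity)]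
      have hcoef : (n : ℂ) ^ (k - 1) * ((d : ℂ) ^ (-k) * d) = (e : ℂ) ^ (k - 1) := by
        have hdc : (d : ℂ) ≠ 0 := by exact_mod_cast hd0.ne'
        rw [hd, Nat.cast_mul, mul_zpow, ← zpow_add_one₀ hdc, mul_assoc, ← zpow_add₀ hdc]
        simp
      simp only [Function.comp_apply, dvd_mul_right, if_true, hidx]
      rw [← hcoef]
      ring
    · intro m hm
      have : ¬ e ∣ m := fun ⟨l, hl⟩ ↦ hm ⟨l, hl.symm⟩
      simp [this]
  refine (congrArg (HasSum · _) (funext fun m ↦ ?_)).mp (hasSum_sum key)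
  rw [← Finset.sum_filter, smul_eq_mul, Finset.sum_mul]
  refine Finset.sum_congr ?_ fun _ _ ↦ rfl
  ext e
  simp only [Finset.mem_filter, Nat.mem_divisors, Nat.dvd_gcd_iff]
  have hg : m.gcd n ≠ 0 := Nat.gcd_ne_zero_right hn
  tauto

/-! ### Integral expansions of `E₄`, `E₆` and `Δ` -/

open ArithmeticFunction.sigma

/-- The power series `∑ σ_j(n) q ^ n`. -/
noncomputable def sigmaSeries (j : ℕ) : ℤ⟦X⟧ := PowerSeries.mk fun m ↦ (σ j m : ℤ)

/-- The integral `q`-expansion of `E₄`. -/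
noncomputable def E4Series : ℤ⟦X⟧ := 1 + 240 * sigmaSeries 3

/-- The integral `q`-expansion of `E₆`. -/
noncomputable def E6Series : ℤ⟦X⟧ := 1 - 504 * sigmaSeries 5

lemma twelve_dvd_sigma (m : ℕ) : (12 : ℤ) ∣ 5 * σ 3 m + 7 * σ 5 m := by
  rw [ArithmeticFunction.sigma_apply, ArithmeticFunction.sigma_apply]
  push_cast
  rw [Finset.mul_sum, Finset.mul_sum, ← Finset.sum_add_distrib]
  refine Finset.dvd_sum fun d _ ↦ ?_
  have h : ∀ x : ZMod 12, 5 * x ^ 3 + 7 * x ^ 5 = 0 := by decide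
  refine (ZMod.intCast_zmod_eq_zero_iff_dvd (5 * (d : ℤ) ^ 3 + 7 * (d : ℤ) ^ 5) 12).mp ?_
  push_cast
  exact h d

/-- The series `∑ (5 σ₃(n) + 7 σ₅(n)) / 12 q ^ n`, which is integral. -/
noncomputable def mixedSigmaSeries : ℤ⟦X⟧ :=
  PowerSeries.mk fun m ↦ (5 * σ 3 m + 7 * σ 5 m) / 12

lemma twelve_mul_mixedSigmaSeries :
    12 * mixedSigmaSeries = 5 * sigmaSeries 3 + 7 * sigmaSeries 5 := by
  ext m
  have h (a : ℤ) (P : ℤ⟦X⟧) : (PowerSeries.C a * P).coeff m = a * P.coeff m :=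
    PowerSeries.coeff_C_mul m P a
  rw [map_add, show (12 : ℤ⟦X⟧) = PowerSeries.C 12 from rfl,
    show (5 : ℤ⟦X⟧) = PowerSeries.C 5 from rfl, show (7 : ℤ⟦X⟧) = PowerSeries.C 7 from rfl, h, h, h]
  simpa [mixedSigmaSeries, sigmaSeries] using Int.mul_ediv_cancel' (twelve_dvd_sigma m)

/-- The integral `q`-expansion of `Δ`, obtained from `1728 Δ = E₄³ - E₆²` by expanding and
cancelling the common factor `1728`. -/
noncomputable def deltaSeries : ℤ⟦X⟧ :=
  mixedSigmaSeries + 100 * sigmaSeries 3 ^ 2 - 147 * sigmaSeries 5 ^ 2 + 8000 * sigmaSeries 3 ^ 3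

lemma deltaSeries_eq : 1728 * deltaSeries = E4Series ^ 3 - E6Series ^ 2 := by
  rw [deltaSeries, E4Series, E6Series]
  linear_combination 144 * twelve_mul_mixedSigmaSeries

lemma map_E4Series : E4Series.map (Int.castRingHom ℂ) = qExpansion 1 E₄ := by
  ext m
  rw [EisensteinSeries.E_qExpansion_coeff _ ⟨2, rfl⟩, show bernoulli 4 = -1 / 30 by decide +kernel,
    show E4Series = 1 + PowerSeries.C 240 * sigmaSeries 3 from rfl,
    PowerSeries.coeff_map, map_add, PowerSeries.coeff_C_mul]
  rcases eq_or_ne m 0 with rfl | hm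
  · simp [sigmaSeries]
  · norm_num [sigmaSeries, PowerSeries.coeff_one, hm]

lemma map_E6Series : E6Series.map (Int.castRingHom ℂ) = qExpansion 1 E₆ := by
  ext m
  rw [EisensteinSeries.E_qExpansion_coeff _ ⟨3, rfl⟩, show bernoulli 6 = 1 / 42 by decide +kernel,
    show E6Series = 1 - PowerSeries.C 504 * sigmaSeries 5 from rfl,
    PowerSeries.coeff_map, map_sub, PowerSeries.coeff_C_mul]
  rcases eq_or_ne m 0 with rfl | hm
  · simp [sigmaSeries]
  · norm_num [sigmaSeries, PowerSeries.coeff_one, hm]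

lemma map_deltaSeries :
    deltaSeries.map (Int.castRingHom ℂ) = qExpansion 1 CuspForm.discriminant := by
  have h1 : (1728 : ℂ) • (CuspForm.discriminant : ℍ → ℂ) =
      (mcast (by norm_num) (E₄.pow 3) - mcast (by norm_num) (E₆.pow 2) : ModularForm 𝒮ℒ 12) := by
    ext z
    have := discriminant_eq_E₄_cube_sub_E₆_sq z
    simp only [Pi.smul_apply, CuspForm.coe_discriminant, this, FunLike.coe_sub, coe_mcast, coe_pow,
      Pi.sub_apply, Pi.pow_apply, smul_eq_mul]
    ring
  have h2 := ModularForm.qExpansion_smul one_pos one_mem_strictPeriods_SL (1728 : ℂ)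
    CuspForm.discriminant
  rw [h1, FunLike.coe_sub, ModularForm.qExpansion_sub one_pos one_mem_strictPeriods_SL, coe_mcast,
    coe_mcast, ModularForm.qExpansion_pow one_pos one_mem_strictPeriods_SL,
    ModularForm.qExpansion_pow one_pos one_mem_strictPeriods_SL, ← map_E4Series, ← map_E6Series,
    ← map_pow, ← map_pow, ← map_sub, ← deltaSeries_eq, PowerSeries.smul_eq_C_mul, map_mul] at h2
  refine mul_left_cancel₀ (a := PowerSeries.C (1728 : ℂ)) (by simp) ?_
  rw [← h2, show (1728 : ℤ⟦X⟧) = PowerSeries.C 1728 from rfl, PowerSeries.map_C]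
  simp

lemma coeff_zero_deltaSeries : deltaSeries.coeff 0 = 0 := by
  simp [deltaSeries, mixedSigmaSeries, sigmaSeries]

lemma coeff_one_deltaSeries : deltaSeries.coeff 1 = 1 := by
  simp [deltaSeries, mixedSigmaSeries, sigmaSeries, pow_succ, PowerSeries.coeff_mul,
    Finset.Nat.antidiagonal_succ]

/-- The series of `Δ` is `q` times a series with constant coefficient `1`. -/
lemma exists_deltaSeries_eq_X_mul :
    ∃ U : ℤ⟦X⟧, deltaSeries = PowerSeries.X * U ∧ U.constantCoeff = 1 := by
  obtain ⟨U, hU⟩ := PowerSeries.X_dvd_iff.mpr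
    ((PowerSeries.coeff_zero_eq_constantCoeff_apply _).symm.trans coeff_zero_deltaSeries)
  refine ⟨U, hU, ?_⟩
  have h := coeff_one_deltaSeries
  rwa [hU, PowerSeries.coeff_succ_X_mul, PowerSeries.coeff_zero_eq_constantCoeff_apply] at h

/-! ### The Sturm bound for congruences -/

/-- The integral `q`-expansion of `E₄ ^ (3 * (r - i)) * Δ ^ i`. -/
noncomputable def monomialSeries (r i : ℕ) : ℤ⟦X⟧ :=
  E4Series ^ (3 * (r - i)) * deltaSeries ^ i

/-- The modular form `E₄ ^ (3 * (r - i)) * Δ ^ i` of weight `12 * r`. -/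
noncomputable def monomialForm (r i : ℕ) (hi : i ≤ r) {k : ℤ} (hk : k = 12 * r) :
    ModularForm 𝒮ℒ k :=
  mcast (by push_cast [hi]; lia)
    ((E₄.pow (3 * (r - i))).mul (CuspForm.discriminant.toModularFormₗ.pow i))

lemma map_monomialSeries (r i : ℕ) (hi : i ≤ r) {k : ℤ} (hk : k = 12 * r) :
    (monomialSeries r i).map (Int.castRingHom ℂ) = qExpansion 1 (monomialForm r i hi hk) := by
  rw [monomialForm, coe_mcast, ModularForm.qExpansion_mul one_pos one_mem_strictPeriods_SL,
    ModularForm.qExpansion_pow one_pos one_mem_strictPeriods_SL,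
    ModularForm.qExpansion_pow one_pos one_mem_strictPeriods_SL, monomialSeries, map_mul, map_pow,
    map_pow, map_E4Series, map_deltaSeries]
  rfl

lemma constantCoeff_E4Series : E4Series.constantCoeff = 1 := by
  simp [E4Series, sigmaSeries]

/-- The series of `E₄ ^ (3 * (r - i)) * Δ ^ i` starts with `q ^ i`. -/
lemma coeff_monomialSeries (r i j : ℕ) (hj : j ≤ i) :
    (monomialSeries r i).coeff j = if j = i then 1 else 0 := by
  obtain ⟨U, hU, hU1⟩ := exists_deltaSeries_eq_X_mul
  rw [monomialSeries, hU, mul_pow, mul_left_comm]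
  rcases hj.eq_or_lt with rfl | hlt
  · simp [PowerSeries.coeff_X_pow_mul', hU1, constantCoeff_E4Series]
  · rw [PowerSeries.coeff_X_pow_mul', if_neg hlt.not_ge, if_neg hlt.ne]

/-- A congruence form of the Sturm bound in weight `12 * r`: if the first coefficients of an
integral `q`-expansion are divisible by `M`, up to `q ^ r`, then all of them are. -/
theorem dvd_coeff_of_forall_le {r : ℕ} {k : ℤ} (hk : k = 12 * r) (g : ModularForm 𝒮ℒ k)
    {G : ℤ⟦X⟧} (hG : G.map (Int.castRingHom ℂ) = qExpansion 1 g) {M : ℤ}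
    (hM : ∀ i ≤ r, M ∣ G.coeff i) (m : ℕ) : M ∣ G.coeff m := by
  -- integral combinations of the forms `E₄ ^ (3 * (r - i)) * Δ ^ i` match `g / M` up to `q ^ r`
  have key : ∀ j ≤ r + 1, ∃ (P : ℤ⟦X⟧) (p : ModularForm 𝒮ℒ k),
      P.map (Int.castRingHom ℂ) = qExpansion 1 p ∧ ∀ i < j, G.coeff i = M * P.coeff i := by
    intro j
    induction j with
    | zero => exact fun _ ↦ ⟨0, 0, by simp [qExpansion_zero], by simp⟩
    | succ j ih =>
      intro hj
      obtain ⟨P, p, hP, hPj⟩ := ih (by lia)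
      obtain ⟨t, ht⟩ := hM j (by lia)
      refine ⟨P + PowerSeries.C (t - P.coeff j) * monomialSeries r j,
        p + ((t - P.coeff j : ℤ) : ℂ) • monomialForm r j (by lia) hk, ?_, fun i hi ↦ ?_⟩
      · rw [FunLike.coe_add, ModularForm.qExpansion_add one_pos one_mem_strictPeriods_SL,
          FunLike.coe_smul, ModularForm.qExpansion_smul one_pos one_mem_strictPeriods_SL, map_add,
          map_mul, hP, map_monomialSeries r j (by lia) hk, PowerSeries.map_C,
          PowerSeries.smul_eq_C_mul]
        rfl
      · rw [map_add, PowerSeries.coeff_C_mul, coeff_monomialSeries r j i (by lia)]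
        rcases eq_or_ne i j with rfl | hij
        · simp [ht]
        · simp [hij, hPj i (by lia)]
  obtain ⟨P, p, hP, hPj⟩ := key (r + 1) le_rfl
  have hq : (G - PowerSeries.C M * P).map (Int.castRingHom ℂ) =
      qExpansion 1 (g - (M : ℂ) • p : ModularForm 𝒮ℒ k) := by
    rw [FunLike.coe_sub, ModularForm.qExpansion_sub one_pos one_mem_strictPeriods_SL,
      FunLike.coe_smul, ModularForm.qExpansion_smul one_pos one_mem_strictPeriods_SL, map_sub,
      map_mul, hP, hG, PowerSeries.map_C, PowerSeries.smul_eq_C_mul]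
    rfl
  have hzero : g - (M : ℂ) • p = 0 := by
    refine sturm_bound_levelOne ?_
    have hr : k.toNat / 12 = r := by lia
    rw [hr, ← hq]
    refine lt_of_lt_of_le (b := ((r + 1 : ℕ) : ℕ∞)) (by exact_mod_cast r.lt_succ_self)
      (PowerSeries.nat_le_order _ _ fun i hi ↦ ?_)
    rw [PowerSeries.coeff_map, map_sub, PowerSeries.coeff_C_mul, hPj i hi, sub_self, map_zero]
  rw [hzero, FunLike.coe_zero, qExpansion_zero] at hq
  have hcoeff := congrArg (PowerSeries.coeff m) hq
  rw [PowerSeries.coeff_map, map_zero, map_sub, PowerSeries.coeff_C_mul, eq_intCast,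
    Int.cast_eq_zero, sub_eq_zero] at hcoeff
  exact ⟨_, hcoeff⟩

/-! ### The form `f` and its Hecke translates -/

/-- The integral `q`-expansion of `f = E₄ ^ 6 * Δ + 2 * Δ ^ 3`. -/
noncomputable def fSeries : ℤ⟦X⟧ := E4Series ^ 6 * deltaSeries + 2 * deltaSeries ^ 3

/-- The cusp form `f` as a modular form. -/
noncomputable def fForm : ModularForm 𝒮ℒ 36 := f.toModularFormₗ

lemma map_fSeries : fSeries.map (Int.castRingHom ℂ) = qExpansion 1 f := by
  have h36 : (36 : ℤ) = 12 * (3 : ℕ) := by norm_num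
  have h : (f : ℍ → ℂ) =
      (monomialForm 3 1 (by norm_num) h36 + (2 : ℂ) • monomialForm 3 3 le_rfl h36 :
        ModularForm 𝒮ℒ 36) := by
    ext z
    have h1 : monomialForm 3 1 (by norm_num) h36 z =
        E₄ z ^ 6 * CuspForm.discriminant z ^ 1 := rfl
    have h3 : monomialForm 3 3 le_rfl h36 z = E₄ z ^ 0 * CuspForm.discriminant z ^ 3 := rfl
    rw [f_apply, FunLike.coe_add, Pi.add_apply, FunLike.coe_smul, Pi.smul_apply, h1, h3,
      smul_eq_mul, pow_one, pow_zero, one_mul]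
  rw [h, FunLike.coe_add, ModularForm.qExpansion_add one_pos one_mem_strictPeriods_SL,
    FunLike.coe_smul, ModularForm.qExpansion_smul one_pos one_mem_strictPeriods_SL,
    ← map_monomialSeries, ← map_monomialSeries, fSeries, monomialSeries, monomialSeries,
    PowerSeries.smul_eq_C_mul, show (2 : ℤ⟦X⟧) = PowerSeries.C 2 from rfl, map_add, map_mul,
    map_mul, PowerSeries.map_C]
  simp

/-- The integral `q`-expansion of `T_n f`. -/
noncomputable def heckeSeries (n : ℕ) : ℤ⟦X⟧ := PowerSeries.mk fun m ↦
  ∑ e ∈ (m.gcd n).divisors, (e : ℤ) ^ 35 * fSeries.coeff (m * n / e ^ 2)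

lemma coeff_heckeSeries_comm (m n : ℕ) : (heckeSeries n).coeff m = (heckeSeries m).coeff n := by
  simp only [heckeSeries, PowerSeries.coeff_mk, Nat.gcd_comm m n, mul_comm m n]

lemma map_heckeSeries {n : ℕ} (hn : n ≠ 0) :
    (heckeSeries n).map (Int.castRingHom ℂ) = qExpansion 1 (heckeForm n hn fForm) := by
  ext m
  have h : (fForm : ℍ → ℂ) = f := rfl
  rw [coeff_heckeForm, h, ← map_fSeries]
  simp only [heckeSeries, PowerSeries.coeff_map, PowerSeries.coeff_mk, map_sum, map_mul, map_pow]
  refine Finset.sum_congr rfl fun e _ ↦ ?_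
  rw [map_natCast, show (36 : ℤ) - 1 = (35 : ℕ) from rfl, zpow_natCast]

/-! ### Coefficients of `f` modulo `4` -/

/-- The reduction modulo `4` of the coefficients of `Δ`, in terms of divisor sums: modulo `4`, only
the linear term and the square of `∑ σ₅(n) q ^ n` survive in `deltaSeries`. The kernel can evaluate
this expression. -/
def deltaMod (n : ℕ) : ZMod 4 :=
  ((5 * σ 3 n + 7 * σ 5 n) / 12 : ℤ) +
    ∑ p ∈ Finset.HasAntidiagonal.antidiagonal n, (σ 5 p.1 : ZMod 4) * (σ 5 p.2 : ZMod 4)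

lemma coeff_deltaSeries_mod (n : ℕ) : (deltaSeries.coeff n : ZMod 4) = deltaMod n := by
  have h1 : deltaSeries = mixedSigmaSeries + sigmaSeries 5 * sigmaSeries 5 + PowerSeries.C 4 *
      (25 * sigmaSeries 3 ^ 2 - 37 * sigmaSeries 5 ^ 2 + 2000 * sigmaSeries 3 ^ 3) := by
    rw [deltaSeries, show (PowerSeries.C 4 : ℤ⟦X⟧) = 4 from rfl]
    ring
  have h4 : (4 : ZMod 4) = 0 := rfl
  rw [h1, map_add, map_add, PowerSeries.coeff_C_mul, PowerSeries.coeff_mul, mixedSigmaSeries,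
    sigmaSeries, deltaMod]
  push_cast
  rw [h4]
  simp

lemma coeff_fSeries_mod (n : ℕ) : (fSeries.coeff n : ZMod 4) = deltaMod n +
    2 * ∑ p ∈ Finset.HasAntidiagonal.antidiagonal n, (∑ s ∈ Finset.HasAntidiagonal.antidiagonal p.1,
      deltaMod s.1 * deltaMod s.2) * deltaMod p.2 := by
  obtain ⟨R, hR⟩ : ∃ R, E4Series ^ 6 = 1 + PowerSeries.C 4 * R := by
    obtain ⟨R, hR⟩ : (4 : ℤ⟦X⟧) ∣ E4Series ^ 6 - 1 := by
      refine dvd_trans ?_ (sub_one_dvd_pow_sub_one E4Series 6)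
      exact ⟨60 * sigmaSeries 3, by rw [E4Series]; ring⟩
    exact ⟨R, by rw [show (PowerSeries.C 4 : ℤ⟦X⟧) = 4 from rfl, ← hR]; ring⟩
  have h1 : fSeries = deltaSeries + PowerSeries.C 4 * (R * deltaSeries) +
      PowerSeries.C 2 * (deltaSeries * deltaSeries * deltaSeries) := by
    rw [fSeries, hR, show (PowerSeries.C 2 : ℤ⟦X⟧) = 2 from rfl]
    ring
  have h4 : (4 : ZMod 4) = 0 := rfl
  rw [h1, map_add, map_add, PowerSeries.coeff_C_mul, PowerSeries.coeff_C_mul,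
    PowerSeries.coeff_mul _ (deltaSeries * deltaSeries)]
  simp only [PowerSeries.coeff_mul]
  push_cast
  simp only [coeff_deltaSeries_mod]
  rw [h4]
  simp

/-- The first coefficients of `f` modulo `4`. -/
lemma coeff_fSeries_mod_eq (n : ℕ) (hn : n < 10) :
    (fSeries.coeff n : ZMod 4) =
      if n = 1 ∨ n = 9 then 1 else if n = 3 ∨ n = 5 then 2 else 0 := by
  have h : ∀ n < 10, deltaMod n + 2 * ∑ p ∈ Finset.HasAntidiagonal.antidiagonal n,
      (∑ s ∈ Finset.HasAntidiagonal.antidiagonal p.1, deltaMod s.1 * deltaMod s.2) *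
        deltaMod p.2 = if n = 1 ∨ n = 9 then 1 else if n = 3 ∨ n = 5 then 2 else 0 := by
    decide +kernel
  rw [coeff_fSeries_mod, h n hn]

lemma coeff_zero_fSeries : fSeries.coeff 0 = 0 := by
  have h := coeff_zero_deltaSeries
  rw [PowerSeries.coeff_zero_eq_constantCoeff_apply] at h ⊢
  simp [fSeries, h]

lemma coeff_one_fSeries : fSeries.coeff 1 = 1 := by
  obtain ⟨U, hU, hU1⟩ := exists_deltaSeries_eq_X_mul
  have h : fSeries = PowerSeries.X * (E4Series ^ 6 * U + 2 * PowerSeries.X ^ 2 * U ^ 3) := by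
    rw [fSeries, hU]
    ring
  rw [h, PowerSeries.coeff_succ_X_mul, PowerSeries.coeff_zero_eq_constantCoeff_apply]
  simp [hU1, constantCoeff_E4Series]

/-! ### The congruence `T_n f ≡ a_n f` -/

lemma coeff_zero_heckeSeries (n : ℕ) : (heckeSeries n).coeff 0 = 0 := by
  simp [heckeSeries, coeff_zero_fSeries]

lemma coeff_one_heckeSeries (n : ℕ) : (heckeSeries n).coeff 1 = fSeries.coeff n := by
  simp [heckeSeries]

/-- If `T_n f` and `a_n(f) f` agree modulo `4` up to `q ^ 3`, then they agree modulo `4`. It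
suffices to look at `q ^ 2` and `q ^ 3`, as the coefficients at `q ^ 0` and `q ^ 1` are equal. -/
lemma heckeSeries_mod {n : ℕ} (hn : n ≠ 0)
    (h2 : (4 : ℤ) ∣ (heckeSeries n).coeff 2 - fSeries.coeff n * fSeries.coeff 2)
    (h3 : (4 : ℤ) ∣ (heckeSeries n).coeff 3 - fSeries.coeff n * fSeries.coeff 3) (m : ℕ) :
    (4 : ℤ) ∣ (heckeSeries n).coeff m - fSeries.coeff n * fSeries.coeff m := by
  have hG : (heckeSeries n - PowerSeries.C (fSeries.coeff n) * fSeries).map (Int.castRingHom ℂ) =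
      qExpansion 1 (heckeForm n hn fForm - ((fSeries.coeff n : ℤ) : ℂ) • fForm :
        ModularForm 𝒮ℒ 36) := by
    rw [FunLike.coe_sub, ModularForm.qExpansion_sub one_pos one_mem_strictPeriods_SL,
      FunLike.coe_smul, ModularForm.qExpansion_smul one_pos one_mem_strictPeriods_SL, map_sub,
      map_mul, map_heckeSeries hn, map_fSeries, PowerSeries.map_C, PowerSeries.smul_eq_C_mul]
    rfl
  have h := dvd_coeff_of_forall_le (r := 3) (by norm_num) _ hG (M := 4) ?_ m
  · simpa only [map_sub, PowerSeries.coeff_C_mul] using h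
  · intro i hi
    rw [map_sub, PowerSeries.coeff_C_mul]
    interval_cases i
    · simp [coeff_zero_heckeSeries, coeff_zero_fSeries]
    · simp [coeff_one_heckeSeries, coeff_one_fSeries]
    · exact h2
    · exact h3

lemma four_dvd_sub_mul_iff (x y z : ℤ) :
    (4 : ℤ) ∣ x - y * z ↔ (x : ZMod 4) = (y : ZMod 4) * (z : ZMod 4) := by
  rw [← sub_eq_zero, ← Int.cast_mul, ← Int.cast_sub]
  exact (ZMod.intCast_zmod_eq_zero_iff_dvd _ 4).symm

lemma coeff_heckeSeries_prime {p : ℕ} (hp : p.Prime) (m : ℕ) :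
    (heckeSeries p).coeff m = fSeries.coeff (m * p) +
      if p ∣ m then (p : ℤ) ^ 35 * fSeries.coeff (m / p) else 0 := by
  rw [heckeSeries, PowerSeries.coeff_mk]
  split_ifs with h
  · rw [Nat.gcd_eq_right h, hp.sum_divisors, add_comm]
    simp [sq, Nat.mul_div_mul_right _ _ hp.pos]
  · rw [(hp.coprime_iff_not_dvd.mpr h).symm.gcd_eq_one]
    simp

lemma heckeSeries_two_mod (m : ℕ) :
    (4 : ℤ) ∣ (heckeSeries 2).coeff m - fSeries.coeff 2 * fSeries.coeff m := by
  refine heckeSeries_mod two_ne_zero ?_ ?_ m <;>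
  · rw [four_dvd_sub_mul_iff, coeff_heckeSeries_prime Nat.prime_two]
    norm_num [coeff_fSeries_mod_eq]
    try decide

lemma heckeSeries_three_mod (m : ℕ) :
    (4 : ℤ) ∣ (heckeSeries 3).coeff m - fSeries.coeff 3 * fSeries.coeff m := by
  refine heckeSeries_mod three_ne_zero ?_ ?_ m <;>
  · rw [four_dvd_sub_mul_iff, coeff_heckeSeries_prime Nat.prime_three]
    norm_num [coeff_fSeries_mod_eq]
    try decide

/-- By the symmetry of the coefficients of `T_n f`, the coefficient of `T_n f` at `q ^ p` is that
of `T_p f` at `q ^ n`, so that the case `n = p` for `p = 2, 3` gives the general one. -/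
lemma heckeSeries_mod_four {n : ℕ} (hn : n ≠ 0) (m : ℕ) :
    (4 : ℤ) ∣ (heckeSeries n).coeff m - fSeries.coeff n * fSeries.coeff m := by
  refine heckeSeries_mod hn ?_ ?_ m
  · rw [coeff_heckeSeries_comm, mul_comm]
    exact heckeSeries_two_mod n
  · rw [coeff_heckeSeries_comm, mul_comm]
    exact heckeSeries_three_mod n

end WeakEigenform

theorem proposition2p2 : WeakEigenform.IsWeakEigenform 4 WeakEigenform.f := by
  refine ⟨?_, WeakEigenform.fSeries.map (Int.castRingHom (ZMod 4)),
    ⟨_, WeakEigenform.map_fSeries, rfl⟩, fun n hn ↦ ?_⟩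
  · rw [← WeakEigenform.map_fSeries, PowerSeries.coeff_map, WeakEigenform.coeff_one_fSeries]
    simp
  · have hn0 : n ≠ 0 := Nat.one_le_iff_ne_zero.mp hn
    refine ⟨WeakEigenform.heckeSeries n, WeakEigenform.map_heckeSeries hn0, ?_⟩
    ext m
    simpa using (WeakEigenform.four_dvd_sub_mul_iff _ _ _).mp
      (WeakEigenform.heckeSeries_mod_four hn0 m)
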